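/- Let $r\ge 3$ and let $l\ge 5$ be odd. An $r$-uniform loose cycle of length $l$, denoted $C_l^r$, is a hypergraph with $l$ edges $e_1,\dots,e_l$, each of size $r$, such that for $i\neq j$ we have $|e_i\cap e_j|=1$ if $j\equiv i\pm 1 \pmod l$ and $e_i\cap e_j=\emptyset$ otherwise. Let $K_n^r$ denote the complete $r$-uniform hypergraph on $n$ vertices, and let $R(C_l^r,K_n^r)$ be the least integer $m$ such that every colouring of the edges of $K_m^r$ with red and blue contains a copy of $C_l^r$ all of whose edges are red or a copy of $K_n^r$ all of whose edges are blue. Then there is a constant $c_{r,l}>0$, depending only on $r$ and $l$, such that for every integer $n\ge 1$ the number $R(C_l^r,K_n^r)$ exists and $$R(C_l^r,K_n^r)\le c_{r,l}\, n^{1+1/\lfloor l/2\rfloor}.$$ -/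

import Mathlib

namespace LooseCycleRamsey

/-- The edges of the complete `r`-uniform hypergraph on the vertex set `V`. -/
abbrev CompleteEdge (V : Type*) (r : ℕ) : Type _ := {e : Finset V // e.card = r}

/-- The two colours. -/
inductive Color
  | red
  | blue

/-- The sets `e i`, indexed cyclically by `i : ZMod l`, are the edges of a loose cycle of length
`l`: cyclically consecutive edges share exactly one vertex, and any two other edges are
disjoint. (For `l ≥ 4` and edges of size at least `2` the `l` edges are then pairwise distinct.) -/
def IsLooseCycle {V : Type*} [DecidableEq V] {l : ℕ} (e : ZMod l → Finset V) : Prop :=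
  ∀ i j : ZMod l, i ≠ j →
    if j = i + 1 ∨ j = i - 1 then (e i ∩ e j).card = 1 else e i ∩ e j = ∅

/-- The coloured complete `r`-uniform hypergraph contains a red `r`-uniform loose cycle of
length `l`. -/
def HasRedLooseCycle {V : Type*} [DecidableEq V] {r : ℕ} (l : ℕ)
    (χ : CompleteEdge V r → Color) : Prop :=
  ∃ e : ZMod l → CompleteEdge V r,
    IsLooseCycle (fun i => (e i : Finset V)) ∧ ∀ i, χ (e i) = Color.red

/-- The coloured complete `r`-uniform hypergraph contains a blue `r`-uniform clique of
order `n`. -/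
def HasBlueClique {V : Type*} {r : ℕ} (n : ℕ) (χ : CompleteEdge V r → Color) : Prop :=
  ∃ S : Finset V, S.card = n ∧ ∀ e : CompleteEdge V r, (e : Finset V) ⊆ S → χ e = Color.blue

/-- Every red/blue colouring of the edges of the complete `r`-uniform hypergraph on `m` vertices
contains a red loose cycle of length `l` or a blue clique of order `n`. -/
def Arrows (r l n m : ℕ) : Prop :=
  ∀ χ : CompleteEdge (Fin m) r → Color, HasRedLooseCycle l χ ∨ HasBlueClique n χ

/-- `m` is the Ramsey number of the `r`-uniform loose cycle of length `l` versus the `r`-uniform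
clique of order `n`. -/
def IsRamseyNumber (r l n m : ℕ) : Prop :=
  IsLeast {k : ℕ | Arrows r l n k} m

end LooseCycleRamsey

/-! Let `H` be the red edges of a colouring of order `m` with no red loose cycle of length `l = 2 *
k + 1` and no blue clique of order `n`. Since `H` may have large codegrees, it is replaced by `F =
core H (l * r)`, the minimal sets that extend to an edge of `H` avoiding any `l * r` prescribed
outside vertices. Edges of `F` have between 2 and `r` vertices, and its codegrees are bounded in
terms of `r` and `l` (`codegree_core_le`). Loose cycles of `F` lift to `H`
(`exists_looseCycle_of_robust`), and independent sets of `F` are independent in `H`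
(`Indep.of_core`), hence smaller than `n`.

The crux is `exists_indep_of_loosePaths`: for `1 ≤ j ≤ k`, the ends of loose paths with `j` edges
from `v` contain an independent set of constant proportion. Otherwise, once the loose paths are made
to look alike, a long monotone path runs through their ends. Two of the loose paths, cut off at
their first meeting, have the same number `h` of edges, and a stretch of `2 * k + 1 - 2 * h` edges
of the monotone path closes them up to a forbidden cycle.

So there are `O(n)` ends at distance `k`, and for some `j < k` the layers grow by a factor `O(n ^ (1
/ k))` only. An independent part of layer `j` then has a neighbourhood at most `O(n ^ (1 / k))`
times its own size. Deleting both and repeating (`exists_indep_of_no_looseCycle`) gives an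
independent set of order `m / n ^ (1 / k)`; as it has fewer than `n` vertices, `m = O(n ^ (1 + 1 /
k))`. -/

namespace LooseCycleRamsey

open Finset

/-! ### Reduction to a hypergraph of bounded codegree. -/

section Robust

variable {V : Type*} [DecidableEq V]

/-- No set of at most `M` vertices outside `A` meets all edges of `H` that contain `A`. -/
def Robust (H : Finset (Finset V)) (M : ℕ) (A : Finset V) : Prop :=
  ∀ T : Finset V, T.card ≤ M → Disjoint A T → ∃ h ∈ H, A ⊆ h ∧ Disjoint h T

/-- The minimal robust sets with at least two elements. -/
noncomputable def core [Fintype V] (H : Finset (Finset V)) (M : ℕ) : Finset (Finset V) := by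
  classical
  exact univ.filter fun A => 2 ≤ A.card ∧ Robust H M A ∧
    ∀ B, B ⊂ A → 2 ≤ B.card → ¬ Robust H M B

/-- `I` contains no edge of `F`. -/
def Indep (F : Finset (Finset V)) (I : Finset V) : Prop := ∀ e ∈ F, ¬ e ⊆ I

theorem robust_of_mem {V : Type*} {H : Finset (Finset V)} {M : ℕ} {h : Finset V} (hh : h ∈ H) :
    Robust H M h := fun _ _ hd => ⟨h, hh, Subset.refl _, hd⟩

theorem Robust.card_le {V : Type*} {H : Finset (Finset V)} {M r : ℕ} {A : Finset V}
    (hA : Robust H M A) (hH : ∀ h ∈ H, h.card = r) : A.card ≤ r := by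
  obtain ⟨h, hh, hAh, -⟩ := hA ∅ (by simp) (by simp)
  exact (card_le_card hAh).trans (hH h hh).le

/-- The edges are enlarged one at a time. Robustness lets the new edge avoid every vertex of the
current cycle outside the old edge, so no pairwise intersection changes. -/
theorem exists_looseCycle_of_robust {H : Finset (Finset V)} {r l : ℕ} [NeZero l]
    (hH : ∀ h ∈ H, h.card = r) (e : ZMod l → Finset V) (he : IsLooseCycle e)
    (hR : ∀ i, Robust H (l * r) (e i)) :
    ∃ e' : ZMod l → Finset V, IsLooseCycle e' ∧ ∀ i, e' i ∈ H := by
  have key : ∀ s : Finset (ZMod l), ∃ e' : ZMod l → Finset V, IsLooseCycle e' ∧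
      (∀ i, Robust H (l * r) (e' i)) ∧ ∀ i ∈ s, e' i ∈ H := by
    intro s
    induction s using Finset.induction_on with
    | empty => exact ⟨e, he, hR, by simp⟩
    | insert i s _ ih =>
      obtain ⟨e', hl, hr', hs⟩ := ih
      have hcard : ((univ.biUnion e') \ e' i).card ≤ l * r := by
        calc _ ≤ (univ.biUnion e').card := card_le_card sdiff_subset
          _ ≤ (univ : Finset (ZMod l)).card * r :=
            card_biUnion_le_card_mul _ _ _ fun j _ => (hr' j).card_le hH
          _ = l * r := by rw [card_univ, ZMod.card]
      obtain ⟨h, hh, hsub, hdis⟩ := hr' i _ hcard disjoint_sdiff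
      have hinter : ∀ j, h ∩ e' j = e' i ∩ e' j := by
        intro j
        ext z
        simp only [mem_inter]
        refine ⟨fun hz => ⟨?_, hz.2⟩, fun hz => ⟨hsub hz.1, hz.2⟩⟩
        by_contra hzi
        exact disjoint_left.1 hdis hz.1
          (mem_sdiff.2 ⟨mem_biUnion.2 ⟨j, mem_univ _, hz.2⟩, hzi⟩)
      refine ⟨Function.update e' i h, ?_, ?_, ?_⟩
      · intro a b hab
        have := hl a b hab
        by_cases ha : a = i
        · subst ha
          rw [Function.update_self, Function.update_of_ne (Ne.symm hab), hinter]
          exact this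
        · rw [Function.update_of_ne ha]
          by_cases hb : b = i
          · subst hb
            rw [Function.update_self, inter_comm, hinter, inter_comm]
            exact this
          · rw [Function.update_of_ne hb]
            exact this
      · intro a
        by_cases ha : a = i
        · subst ha
          rw [Function.update_self]
          exact robust_of_mem hh
        · rw [Function.update_of_ne ha]
          exact hr' a
      · intro a ha
        by_cases hai : a = i
        · subst hai
          rw [Function.update_self]
          exact hh
        · rw [Function.update_of_ne hai]
          exact hs a ((mem_insert.1 ha).resolve_left hai)
  obtain ⟨e', hl, -, hs⟩ := key univ
  exact ⟨e', hl, fun i => hs i (mem_univ _)⟩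

variable [Fintype V]

theorem mem_core {H : Finset (Finset V)} {M : ℕ} {A : Finset V} :
    A ∈ core H M ↔ 2 ≤ A.card ∧ Robust H M A ∧
      ∀ B, B ⊂ A → 2 ≤ B.card → ¬ Robust H M B := by
  simp [core]

theorem exists_core_subset {H : Finset (Finset V)} {M : ℕ} (A : Finset V) (h2 : 2 ≤ A.card)
    (hA : Robust H M A) : ∃ B ∈ core H M, B ⊆ A := by
  induction A using Finset.strongInduction with
  | H A ih =>
    by_cases h : ∃ B, B ⊂ A ∧ 2 ≤ B.card ∧ Robust H M B
    · obtain ⟨B, hB, hB2, hBr⟩ := h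
      obtain ⟨C, hC, hCB⟩ := ih B hB hB2 hBr
      exact ⟨C, hC, hCB.trans hB.subset⟩
    · push Not at h
      exact ⟨A, mem_core.2 ⟨h2, hA, h⟩, Subset.refl _⟩

theorem Indep.of_core {H : Finset (Finset V)} {M : ℕ} {I : Finset V}
    (hH : ∀ h ∈ H, 2 ≤ h.card) (hI : Indep (core H M) I) : Indep H I := by
  intro h hh hhI
  obtain ⟨B, hB, hBh⟩ := exists_core_subset (M := M) h (hH h hh) (robust_of_mem hh)
  exact hI B hB (hBh.trans hhI)

/-- If `A` is robust, minimality leaves only `A` itself. If not, a set `T` witnessing this meets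
every core set containing `A`, because a core set missing `T` would extend to an edge missing `T`.
Branching over the at most `M` vertices of `T` enlarges `A` by one. -/
theorem card_core_superset_le {H : Finset (Finset V)} {M r : ℕ} (hM : 1 ≤ M)
    (hH : ∀ h ∈ H, h.card = r) (d : ℕ) (A : Finset V) (hA : 2 ≤ A.card) (hd : r ≤ A.card + d) :
    ((core H M).filter fun B => A ⊆ B).card ≤ M ^ d := by
  induction d generalizing A with
  | zero =>
    have : ((core H M).filter fun B => A ⊆ B) ⊆ {A} := by
      intro B hB
      rw [mem_filter, mem_core] at hB
      rw [mem_singleton]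
      exact (eq_of_subset_of_card_le hB.2 ((hB.1.2.1.card_le hH).trans (by simpa using hd))).symm
    simpa using card_le_card this
  | succ d ih =>
    by_cases hr : Robust H M A
    · have : ((core H M).filter fun B => A ⊆ B) ⊆ {A} := by
        intro B hB
        rw [mem_filter, mem_core] at hB
        rw [mem_singleton]
        by_contra hne
        exact hB.1.2.2 A (hB.2.ssubset_of_ne (Ne.symm hne)) hA hr
      exact (card_le_card this).trans (by simpa using Nat.one_le_pow _ _ hM)
    · unfold Robust at hr
      push Not at hr
      obtain ⟨T, hT, hAT, hno⟩ := hr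
      have hsub : ((core H M).filter fun B => A ⊆ B) ⊆
          T.biUnion fun t => (core H M).filter fun B => insert t A ⊆ B := by
        intro B hB
        rw [mem_filter] at hB
        have hBr := (mem_core.1 hB.1).2.1
        have : ¬ Disjoint B T := by
          intro hBT
          obtain ⟨h, hh, hBh, hhT⟩ := hBr T hT hBT
          exact hno h hh (hB.2.trans hBh) hhT
        obtain ⟨t, htB, htT⟩ := not_disjoint_iff.1 this
        rw [mem_biUnion]
        exact ⟨t, htT, mem_filter.2 ⟨hB.1, insert_subset htB hB.2⟩⟩
      calc _ ≤ _ := card_le_card hsub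
        _ ≤ T.card * M ^ d := card_biUnion_le_card_mul _ _ _ fun t ht => by
            have htA : t ∉ A := fun h => disjoint_left.1 hAT h ht
            have := card_insert_of_notMem htA
            exact ih _ (by omega) (by omega)
        _ ≤ M * M ^ d := Nat.mul_le_mul_right _ hT
        _ = M ^ (d + 1) := by ring

theorem codegree_core_le {H : Finset (Finset V)} {M r : ℕ} (hM : 1 ≤ M)
    (hH : ∀ h ∈ H, h.card = r) {x y : V} (hxy : x ≠ y) :
    ((core H M).filter fun B => x ∈ B ∧ y ∈ B).card ≤ M ^ r := by
  have := card_core_superset_le hM hH r {x, y} (by simp [card_pair hxy]) (by omega)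
  simpa [insert_subset_iff] using this

end Robust

/-! ### Pigeonhole and rainbow colourings. -/

section Colouring

variable {V : Type*}

theorem exists_large_fiber {κ : Type*} [Fintype κ] [Nonempty κ] [DecidableEq κ] (W : Finset V)
    (c : V → κ) : ∃ a, W.card ≤ Fintype.card κ * (W.filter fun x => c x = a).card := by
  by_contra! h
  have hsum : W.card = ∑ a : κ, (W.filter fun x => c x = a).card :=
    card_eq_sum_card_fiberwise fun _ _ => by simp
  have : ∑ a : κ, Fintype.card κ * (W.filter fun x => c x = a).card < ∑ _a : κ, W.card :=
    sum_lt_sum_of_nonempty univ_nonempty fun a _ => h a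
  rw [← mul_sum, ← hsum] at this
  simp at this

/-- Overwriting a colouring on `P` by a fixed injective one loses only its values on `P`, for which
there are at most `q ^ q` possibilities. -/
theorem pow_card_le_mul_card_injOn [Fintype V] [DecidableEq V] {q : ℕ} (P : Finset V)
    (hP : P.card ≤ q) (hq : 0 < q) [DecidablePred fun χ : V → Fin q => Set.InjOn χ P] :
    Fintype.card (V → Fin q) ≤
      q ^ q * ((univ : Finset (V → Fin q)).filter fun χ => Set.InjOn χ P).card := by
  obtain ⟨g⟩ : Nonempty (P ↪ Fin q) := Function.Embedding.nonempty_of_card_le (by simpa using hP)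
  let ov : (V → Fin q) → V → Fin q := fun χ x => if h : x ∈ P then g ⟨x, h⟩ else χ x
  have hov : ∀ χ, Set.InjOn (ov χ) P := by
    intro χ x hx y hy hxy
    have hx' : x ∈ P := hx
    have hy' : y ∈ P := hy
    simpa [ov, hx', hy'] using hxy
  let Φ : (V → Fin q) → (P → Fin q) × {χ : V → Fin q // Set.InjOn χ P} :=
    fun χ => (fun x => χ x, ⟨ov χ, hov χ⟩)
  have hΦ : Function.Injective Φ := by
    intro χ χ' h
    simp only [Φ, Prod.mk.injEq, Subtype.mk.injEq] at h
    funext x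
    by_cases hx : x ∈ P
    · exact congrFun h.1 ⟨x, hx⟩
    · simpa [ov, hx] using congrFun h.2 x
  have := Fintype.card_le_of_injective Φ hΦ
  rw [Fintype.card_prod, Fintype.card_subtype] at this
  refine this.trans (Nat.mul_le_mul_right _ ?_)
  rw [Fintype.card_fun, Fintype.card_fin, Fintype.card_coe]
  exact Nat.pow_le_pow_right hq hP

theorem exists_card_le_mul_card_filter {α β : Type*} (S : Finset α) (hS : S.Nonempty)
    (W : Finset β) (R : α → β → Prop) [∀ a b, Decidable (R a b)] (K : ℕ)
    (h : ∀ b ∈ W, S.card ≤ K * (S.filter fun a => R a b).card) :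
    ∃ a ∈ S, W.card ≤ K * (W.filter fun b => R a b).card := by
  by_contra! hlt
  have h1 : ∑ a ∈ S, K * (W.filter fun b => R a b).card < ∑ _a ∈ S, W.card :=
    sum_lt_sum_of_nonempty hS hlt
  have h2 : ∑ a ∈ S, (W.filter fun b => R a b).card = ∑ b ∈ W, (S.filter fun a => R a b).card :=
    sum_card_bipartiteAbove_eq_sum_card_bipartiteBelow R
  have h3 : ∑ _b ∈ W, S.card ≤ ∑ b ∈ W, K * (S.filter fun a => R a b).card := sum_le_sum h
  rw [← mul_sum, h2, mul_sum] at h1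
  have h4 := h3.trans_lt h1
  rw [sum_const, sum_const, smul_eq_mul, smul_eq_mul, mul_comm] at h4
  exact lt_irrefl _ h4

open Classical in
theorem exists_rainbow_colouring [Fintype V] {q : ℕ} (hq : 0 < q) (W : Finset V)
    (P : V → Finset V) (hP : ∀ x ∈ W, (P x).card ≤ q) :
    ∃ χ : V → Fin q, W.card ≤ q ^ q * (W.filter fun x => Set.InjOn χ (P x)).card := by
  have hne : (univ : Finset (V → Fin q)).Nonempty := ⟨fun _ => ⟨0, hq⟩, mem_univ _⟩
  obtain ⟨χ, -, hχ⟩ := exists_card_le_mul_card_filter univ hne W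
    (fun χ x => Set.InjOn χ (P x)) (q ^ q) fun x hx =>
      pow_card_le_mul_card_injOn (P x) (hP x hx) hq
  exact ⟨χ, hχ⟩

end Colouring

/-! ### Monotone paths or large independent sets. -/

section Monotone

variable {V : Type*} [LinearOrder V]

/-- The edges `e 0, …, e (s - 1)` of `F` inside `W` form a path `x 0 < ⋯ < x s`, where `x i` and
`x (i + 1)` are the extreme vertices of `e i`, and all pairs `x i`, `x (i + 1)` have type `σ`. -/
def IsMonotonePath {T : Type*} (F : Finset (Finset V)) (W : Finset V) (τ : V → V → T) (σ : T)
    (s : ℕ) (x : ℕ → V) (e : ℕ → Finset V) : Prop :=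
  ∀ i < s, e i ∈ F ∧ e i ⊆ W ∧ x i ∈ e i ∧ x (i + 1) ∈ e i ∧
    (∀ z ∈ e i, x i ≤ z ∧ z ≤ x (i + 1)) ∧ x i < x (i + 1) ∧ τ (x i) (x (i + 1)) = σ

theorem IsMonotonePath.snoc {T : Type*} {F : Finset (Finset V)} {W : Finset V} {τ : V → V → T}
    {σ : T} {s : ℕ} {x : ℕ → V} {e : ℕ → Finset V} (h : IsMonotonePath F W τ σ s x e)
    {d : Finset V} {y : V} (hd : d ∈ F) (hdW : d ⊆ W) (hx : x s ∈ d) (hy : y ∈ d)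
    (hle : ∀ z ∈ d, x s ≤ z ∧ z ≤ y) (hlt : x s < y) (hτ : τ (x s) y = σ) :
    IsMonotonePath F W τ σ (s + 1) (Function.update x (s + 1) y) (Function.update e s d) := by
  intro i hi
  by_cases his : i = s
  · subst his
    rw [Function.update_self, Function.update_self, Function.update_of_ne (by omega)]
    exact ⟨hd, hdW, hx, hy, hle, hlt, hτ⟩
  · rw [Function.update_of_ne his, Function.update_of_ne (by omega),
      Function.update_of_ne (by omega)]
    exact h i (by omega)

theorem IsMonotonePath.lt {T : Type*} {F : Finset (Finset V)} {W : Finset V} {τ : V → V → T}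
    {σ : T} {s : ℕ} {x : ℕ → V} {e : ℕ → Finset V} (h : IsMonotonePath F W τ σ s x e)
    {i j : ℕ} (hij : i < j) (hj : j ≤ s) : x i < x j := by
  induction j, hij using Nat.le_induction with
  | base => exact (h i (by omega)).2.2.2.2.2.1
  | succ j hij ih => exact (ih (by omega)).trans (h j (by omega)).2.2.2.2.2.1

/-- A Gallai–Roy argument: each vertex is labelled, for every type, with the length of a longest
monotone path of that type ending there. An edge inside one label class would extend such a path
from its least to its greatest vertex, contradicting equality of the labels or giving `N` edges. -/
theorem exists_isMonotonePath_or_indep {T : Type*} [Fintype T] [DecidableEq T]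
    (F : Finset (Finset V)) (hF : ∀ e ∈ F, 2 ≤ e.card) (W : Finset V) (τ : V → V → T) {N : ℕ}
    (hN : 0 < N) :
    (∃ σ x e, IsMonotonePath F W τ σ N x e) ∨
      ∃ I ⊆ W, Indep F I ∧ W.card ≤ N ^ Fintype.card T * I.card := by
  classical
  by_cases hpath : ∃ σ x e, IsMonotonePath F W τ σ N x e
  · exact Or.inl hpath
  right
  let Ends (σ : T) (y : V) (s : ℕ) : Prop := ∃ x e, IsMonotonePath F W τ σ s x e ∧ x s = y
  have h0 : ∀ σ y, Ends σ y 0 := fun σ y => ⟨fun _ => y, fun _ => ∅, fun i hi => by omega, rfl⟩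
  let c : V → T → Fin N := fun y σ =>
    ⟨Nat.findGreatest (Ends σ y) (N - 1), by
      have := Nat.findGreatest_le (P := Ends σ y) (N - 1); omega⟩
  have : Nonempty (Fin N) := ⟨⟨0, hN⟩⟩
  obtain ⟨a, ha⟩ := exists_large_fiber W c
  refine ⟨_, filter_subset _ _, ?_, by simpa using ha⟩
  intro d hd hdI
  have hne : d.Nonempty := card_pos.1 (by have := hF d hd; omega)
  have hlt : d.min' hne < d.max' hne := min'_lt_max'_of_card d (by have := hF d hd; omega)
  set y := d.min' hne
  set z := d.max' hne
  have hy : y ∈ d := min'_mem _ _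
  have hz : z ∈ d := max'_mem _ _
  have hcy := (mem_filter.1 (hdI hy)).2
  have hcz := (mem_filter.1 (hdI hz)).2
  set σ := τ y z with hσ
  have hcc : Nat.findGreatest (Ends σ y) (N - 1) = Nat.findGreatest (Ends σ z) (N - 1) := by
    have := congrFun (hcy.trans hcz.symm) σ
    simpa [c] using this
  set s := Nat.findGreatest (Ends σ y) (N - 1) with hs
  have hsN : s ≤ N - 1 := Nat.findGreatest_le _
  obtain ⟨x, e, hp, hxs⟩ : Ends σ y s := Nat.findGreatest_spec (Nat.zero_le _) (h0 σ y)
  have hp' := hp.snoc (y := z) hd (fun w hw => (mem_filter.1 (hdI hw)).1) (hxs ▸ hy) hz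
    (fun w hw => ⟨hxs ▸ min'_le _ _ hw, le_max' _ _ hw⟩) (hxs ▸ hlt) (by rw [hxs])
  rcases Nat.lt_or_ge (s + 1) N with h | h
  · have : Ends σ z (s + 1) := ⟨_, _, hp', by simp⟩
    have := Nat.le_findGreatest (by omega : s + 1 ≤ N - 1) this
    omega
  · have : s + 1 = N := by omega
    exact hpath ⟨σ, _, _, this ▸ hp'⟩

/-- This is why types record order comparisons: unlike mere inequality, they are transitive and so
pass from consecutive to arbitrary terms. -/
theorem eq_or_ne_of_cmp_eq {y : ℕ → V} {N : ℕ} {o : Ordering}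
    (h : ∀ i < N, cmp (y i) (y (i + 1)) = o) :
    (∀ s ≤ N, ∀ t ≤ N, y s = y t) ∨ ∀ s ≤ N, ∀ t ≤ N, s ≠ t → y s ≠ y t := by
  have lift : ∀ R : V → V → Prop, (∀ a b c, R a b → R b c → R a c) →
      (∀ i < N, R (y i) (y (i + 1))) → ∀ s t, s < t → t ≤ N → R (y s) (y t) := by
    intro R htr hR s t hst
    induction t, hst using Nat.le_induction with
    | base => exact fun ht => hR s (by omega)
    | succ t hst ih => exact fun ht => htr _ _ _ (ih (by omega)) (hR t (by omega))
  cases o with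
  | lt =>
    have := lift (· < ·) (fun _ _ _ => lt_trans) fun i hi => (cmp_eq_lt_iff _ _).1 (h i hi)
    right
    intro s hs t ht hst
    rcases Nat.lt_or_gt_of_ne hst with hl | hl
    · exact (this s t hl ht).ne
    · exact (this t s hl hs).ne'
  | eq =>
    have := lift (· = ·) (fun _ _ _ => Eq.trans) fun i hi => (cmp_eq_eq_iff _ _).1 (h i hi)
    left
    intro s hs t ht
    rcases Nat.lt_trichotomy s t with hl | hl | hl
    · exact this s t hl ht
    · rw [hl]
    · exact (this t s hl hs).symm
  | gt =>
    have := lift (fun a b => b < a) (fun _ _ _ h h' => h'.trans h)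
      fun i hi => (cmp_eq_gt_iff _ _).1 (h i hi)
    right
    intro s hs t ht hst
    rcases Nat.lt_or_gt_of_ne hst with hl | hl
    · exact (this s t hl ht).ne'
    · exact (this t s hl hs).ne

end Monotone

/-! ### Assembling loose cycles. -/

section Cycle

variable {V : Type*} [DecidableEq V]

theorem isLooseCycle_of_nat {l : ℕ} (hl : 2 ≤ l) (g : ℕ → Finset V)
    (hg : ∀ i j, i < j → j < l →
      if j = i + 1 ∨ (i = 0 ∧ j + 1 = l) then (g i ∩ g j).card = 1 else g i ∩ g j = ∅) :
    IsLooseCycle fun i : ZMod l => g i.val := by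
  have : NeZero l := ⟨by omega⟩
  have : Fact (1 < l) := ⟨by omega⟩
  have hval : ∀ i j : ZMod l, i.val < j.val →
      ((j = i + 1 ∨ j = i - 1) ↔ (j.val = i.val + 1 ∨ (i.val = 0 ∧ j.val + 1 = l))) := by
    intro i j hij
    have hj := ZMod.val_lt j
    have e1 : j = i + 1 ↔ j.val = i.val + 1 := by
      rw [← (ZMod.val_injective l).eq_iff, ZMod.val_add, ZMod.val_one, Nat.mod_eq_of_lt (by omega)]
    have e2 : j = i - 1 ↔ (i.val = 0 ∧ j.val + 1 = l) := by
      rw [eq_sub_iff_add_eq, ← (ZMod.val_injective l).eq_iff, ZMod.val_add, ZMod.val_one]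
      rcases Nat.lt_or_ge (j.val + 1) l with h | h
      · rw [Nat.mod_eq_of_lt h]; omega
      · have : j.val + 1 = l := by omega
        rw [this, Nat.mod_self]; omega
    rw [e1, e2]
  have main : ∀ i j : ZMod l, i.val < j.val →
      if j = i + 1 ∨ j = i - 1 then (g i.val ∩ g j.val).card = 1 else g i.val ∩ g j.val = ∅ := by
    intro i j hij
    have := hg i.val j.val hij (ZMod.val_lt j)
    simp only [hval i j hij]
    exact this
  intro i j hij
  rcases Nat.lt_or_gt_of_ne fun h => hij (ZMod.val_injective l h) with h | h
  · exact main i j h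
  · have := main j i h
    have hc : (j = i + 1 ∨ j = i - 1) ↔ (i = j + 1 ∨ i = j - 1) := by
      constructor <;> rintro (h | h) <;> subst h <;> simp
    simp only [hc, inter_comm (g i.val)]
    exact this

/-- The loose path `p` with `t` edges and the loose paths `g`, `g'` with `h` edges each, which
start at the two ends of `p` and meet in their last edges, close up to a loose cycle. -/
theorem exists_looseCycle_of_paths {l t h : ℕ} (ht : 1 ≤ t) (hh : 1 ≤ h) (hl : l = t + 2 * h)
    {p g g' : ℕ → Finset V} {F : Finset (Finset V)}
    (hpF : ∀ i < t, p i ∈ F) (hgF : ∀ i < h, g i ∈ F) (hgF' : ∀ i < h, g' i ∈ F)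
    (hp1 : ∀ i, i + 1 < t → (p i ∩ p (i + 1)).card = 1)
    (hp2 : ∀ i j, i + 2 ≤ j → j < t → p i ∩ p j = ∅)
    (hg1 : ∀ i, i + 1 < h → (g i ∩ g (i + 1)).card = 1)
    (hg2 : ∀ i j, i + 2 ≤ j → j < h → g i ∩ g j = ∅)
    (hg1' : ∀ i, i + 1 < h → (g' i ∩ g' (i + 1)).card = 1)
    (hg2' : ∀ i j, i + 2 ≤ j → j < h → g' i ∩ g' j = ∅)
    (hpg : (p 0 ∩ g 0).card = 1) (hpg' : (p (t - 1) ∩ g' 0).card = 1)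
    (hpg0 : ∀ i < t, ∀ b < h, (i ≠ 0 ∨ b ≠ 0) → p i ∩ g b = ∅)
    (hpg0' : ∀ i < t, ∀ b < h, (i ≠ t - 1 ∨ b ≠ 0) → p i ∩ g' b = ∅)
    (hgg : (g (h - 1) ∩ g' (h - 1)).card = 1)
    (hgg0 : ∀ b < h, ∀ b' < h, (b ≠ h - 1 ∨ b' ≠ h - 1) → g b ∩ g' b' = ∅) :
    ∃ e : ZMod l → Finset V, IsLooseCycle e ∧ ∀ i, e i ∈ F := by
  have : NeZero l := ⟨by omega⟩
  -- Traverse `p`, then `g'` away from `p`, then `g` backwards to the start of `p`.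
  let G : ℕ → Finset V := fun i =>
    if i < t then p i else if i < t + h then g' (i - t) else g (l - 1 - i)
  have G1 : ∀ i, i < t → G i = p i := fun i hi => if_pos hi
  have G2 : ∀ i, t ≤ i → i < t + h → G i = g' (i - t) := fun i hi hi' => by
    simp only [G]; rw [if_neg (by omega), if_pos hi']
  have G3 : ∀ i, t + h ≤ i → G i = g (l - 1 - i) := fun i hi => by
    simp only [G]; rw [if_neg (by omega), if_neg (by omega)]
  refine ⟨fun i => G i.val, isLooseCycle_of_nat (by omega) G ?_, ?_⟩
  · intro i j hij hj
    split_ifs with hc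
    · rcases Nat.lt_or_ge i t with hi | hi
      · rw [G1 i hi]
        rcases Nat.lt_or_ge j t with hj' | hj'
        · obtain rfl : j = i + 1 := by omega
          rw [G1 _ hj']; exact hp1 i hj'
        · rcases Nat.lt_or_ge j (t + h) with hj'' | hj''
          · rw [G2 j hj' hj'', show i = t - 1 by omega, show j - t = 0 by omega]; exact hpg'
          · rw [G3 j hj'', show i = 0 by omega, show l - 1 - j = 0 by omega]; exact hpg
      · obtain rfl : j = i + 1 := by omega
        rcases Nat.lt_or_ge i (t + h) with hi' | hi'
        · rw [G2 i hi hi']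
          rcases Nat.lt_or_ge (i + 1) (t + h) with hj'' | hj''
          · rw [G2 _ (by omega) hj'', show i + 1 - t = i - t + 1 by omega]
            exact hg1' _ (by omega)
          · rw [G3 _ hj'', show i - t = h - 1 by omega, show l - 1 - (i + 1) = h - 1 by omega,
              inter_comm]
            exact hgg
        · rw [G3 i hi', G3 _ (by omega), inter_comm,
            show l - 1 - i = l - 1 - (i + 1) + 1 by omega]
          exact hg1 _ (by omega)
    · rcases Nat.lt_or_ge i t with hi | hi
      · rw [G1 i hi]
        rcases Nat.lt_or_ge j t with hj' | hj'
        · rw [G1 _ hj']; exact hp2 i j (by omega) hj'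
        · rcases Nat.lt_or_ge j (t + h) with hj'' | hj''
          · rw [G2 j hj' hj'']; exact hpg0' i hi _ (by omega) (by omega)
          · rw [G3 j hj'']; exact hpg0 i hi _ (by omega) (by omega)
      · rcases Nat.lt_or_ge i (t + h) with hi' | hi'
        · rw [G2 i hi hi']
          rcases Nat.lt_or_ge j (t + h) with hj'' | hj''
          · rw [G2 j (by omega) hj'']; exact hg2' _ _ (by omega) (by omega)
          · rw [G3 j hj'', inter_comm]; exact hgg0 _ (by omega) _ (by omega) (by omega)
        · rw [G3 i hi', G3 j (by omega), inter_comm]; exact hg2 _ _ (by omega) (by omega)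
  · intro i
    have hi := ZMod.val_lt i
    rcases Nat.lt_or_ge i.val t with h1 | h1
    · simp only [G1 _ h1]; exact hpF _ h1
    · rcases Nat.lt_or_ge i.val (t + h) with h2 | h2
      · simp only [G2 _ h1 h2]; exact hgF' _ (by omega)
      · simp only [G3 _ h2]; exact hgF _ (by omega)

end Cycle

/-! ### Loose paths. -/

section LoosePath

variable {V : Type*} [DecidableEq V]

/-- `g 0, …, g (j - 1)` are the edges of a loose path in `F` from `x` to `v`. -/
structure IsLoosePath (F : Finset (Finset V)) (j : ℕ) (v x : V) (g : ℕ → Finset V) : Prop where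
  mem : ∀ b < j, g b ∈ F
  card_inter : ∀ b, b + 1 < j → (g b ∩ g (b + 1)).card = 1
  inter_eq_empty : ∀ b b', b + 2 ≤ b' → b' < j → g b ∩ g b' = ∅
  mem_iff : ∀ b < j, (x ∈ g b ↔ b = 0)
  root_mem : 0 < j → v ∈ g (j - 1)
  eq_root : j = 0 → x = v

theorem IsLoosePath.mono {F F' : Finset (Finset V)} {j : ℕ} {v x : V} {g : ℕ → Finset V}
    (h : IsLoosePath F j v x g) (hF : F ⊆ F') : IsLoosePath F' j v x g :=
  { h with mem := fun b hb => hF (h.mem b hb) }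

theorem IsLoosePath.cons {F : Finset (Finset V)} {j : ℕ} {v x y : V} {g : ℕ → Finset V}
    (h : IsLoosePath F j v y g) {e : Finset V} (he : e ∈ F) (hx : x ∈ e) (hy : y ∈ e)
    (hxy : x ≠ y) (hdis : ∀ b < j, ∀ z ∈ g b, z ∈ e → z = y) :
    ∃ g', IsLoosePath F (j + 1) v x g' := by
  refine ⟨fun b => if b = 0 then e else g (b - 1), ?_, ?_, ?_, ?_, ?_, by simp⟩
  · intro b hb
    rcases Nat.eq_zero_or_pos b with rfl | h0
    · simpa using he
    · simp only [if_neg h0.ne']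
      exact h.mem _ (by omega)
  · intro b hb
    rcases Nat.eq_zero_or_pos b with rfl | h0
    · simp only [if_true, Nat.zero_add, one_ne_zero, if_false, Nat.sub_self]
      rw [card_eq_one]
      refine ⟨y, eq_singleton_iff_unique_mem.2 ⟨mem_inter.2
        ⟨hy, (h.mem_iff 0 (by omega)).2 rfl⟩, fun z hz => ?_⟩⟩
      rw [mem_inter] at hz
      exact hdis 0 (by omega) z hz.2 hz.1
    · simp only [if_neg h0.ne', Nat.add_eq_zero_iff, one_ne_zero, and_false, if_false]
      have := h.card_inter (b - 1) (by omega)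
      rwa [show b - 1 + 1 = b + 1 - 1 by omega] at this
  · intro b b' hbb hb'
    simp only [if_neg (show b' ≠ 0 by omega)]
    rcases Nat.eq_zero_or_pos b with rfl | h0
    · simp only [if_true]
      rw [← not_nonempty_iff_eq_empty]
      rintro ⟨z, hz⟩
      rw [mem_inter] at hz
      have hzy := hdis _ (by omega) z hz.2 hz.1
      have := (h.mem_iff (b' - 1) (by omega)).1 (hzy ▸ hz.2)
      omega
    · simp only [if_neg h0.ne']
      exact h.inter_eq_empty _ _ (by omega) (by omega)
  · intro b hb
    rcases Nat.eq_zero_or_pos b with rfl | h0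
    · simpa using hx
    · simp only [h0.ne', iff_false]
      exact fun hxg => hxy (hdis _ (by omega) x hxg hx)
  · intro _
    rcases Nat.eq_zero_or_pos j with rfl | h0
    · simpa using h.eq_root rfl ▸ hy
    · simp only [Nat.add_sub_cancel, if_neg h0.ne']
      exact h.root_mem h0

/-- The proportion in `exists_indep_of_loosePaths`. -/
def indepConst (r D k : ℕ) : ℕ :=
  (r * k) ^ (r * k) * Fintype.card ((Fin k → Finset (Fin (r * k))) × Fin (r * k)) *
    (2 * k + 1 + D) ^ Fintype.card (Fin (r * k) → Ordering)

theorem indepConst_pos {r k : ℕ} (hr : 0 < r) (hk : 0 < k) (D : ℕ) : 0 < indepConst r D k := by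
  have hq : 0 < r * k := Nat.mul_pos hr hk
  have : Nonempty (Fin (r * k)) := ⟨⟨0, hq⟩⟩
  unfold indepConst
  have := Fintype.card_pos (α := (Fin k → Finset (Fin (r * k))) × Fin (r * k))
  positivity

end LoosePath

/-! ### Independent sets among the ends of loose paths. -/

section Paths

variable {V : Type*} [LinearOrder V]

/-- Loose paths from `v` to the vertices of a sequence, in coloured form: `g s` is a path from
`x s` to `v` whose vertices have different colours, the edges in the same place of two paths carry
the same colours, and for each colour the vertices `φ c s` of colour `c` are all equal or all
different. -/
structure IsUniformPathSystem (F : Finset (Finset V)) (j : ℕ) (v : V) {q : ℕ} (χ : V → Fin q)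
    (N : ℕ) (x : ℕ → V) (g : ℕ → ℕ → Finset V) (φ : Fin q → ℕ → V) : Prop where
  path : ∀ s ≤ N, IsLoosePath F j v (x s) (g s)
  colour : ∀ s ≤ N, ∀ t ≤ N, χ (x s) = χ (x t)
  image : ∀ s ≤ N, ∀ t ≤ N, ∀ b < j, (g s b).image χ = (g t b).image χ
  eq_of_mem : ∀ s ≤ N, ∀ b < j, ∀ z ∈ g s b, φ (χ z) s = z
  eq_or_ne : ∀ c, (∀ s ≤ N, ∀ t ≤ N, φ c s = φ c t) ∨ ∀ s ≤ N, ∀ t ≤ N, s ≠ t → φ c s ≠ φ c t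
  injective : ∀ s ≤ N, ∀ t ≤ N, s ≠ t → x s ≠ x t

/-- In a uniform path system any two paths meet first in edges with the same index, which have
exactly one common vertex. -/
theorem IsUniformPathSystem.exists_meeting_index {F : Finset (Finset V)} {j : ℕ} {v : V} {q : ℕ}
    {χ : V → Fin q} {N : ℕ} {x : ℕ → V} {g : ℕ → ℕ → Finset V} {φ : Fin q → ℕ → V}
    (h : IsUniformPathSystem F j v χ N x g φ) (hj : 0 < j) {D : ℕ} (hDN : D ≤ N)
    (hD : ∀ x y : V, x ≠ y → (F.filter fun e => x ∈ e ∧ y ∈ e).card ≤ D) :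
    ∃ a < j, (∀ s ≤ N, ∀ t ≤ N, s ≠ t → (g s a ∩ g t a).card = 1) ∧
      ∀ s ≤ N, ∀ t ≤ N, s ≠ t → ∀ b < a, ∀ b' < j, g s b ∩ g t b' = ∅ := by
  classical
  -- `Sh b` says that the edges with index `b` share a vertex common to all the paths. The root
  -- shows that this holds for `j - 1`; the least such index is the meeting index.
  let Sh : ℕ → Prop := fun b => b < j ∧ ∃ c ∈ (g 0 b).image χ, ∀ s ≤ N, ∀ t ≤ N, φ c s = φ c t
  have shared : ∀ s ≤ N, ∀ t ≤ N, s ≠ t → ∀ b < j, ∀ b' < j, ∀ z ∈ g s b, z ∈ g t b' →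
      ∀ s ≤ N, ∀ t ≤ N, φ (χ z) s = φ (χ z) t := by
    intro s hs t ht hst b hb b' hb' z hz hz'
    refine (h.eq_or_ne (χ z)).resolve_right fun hne => hne s hs t ht hst ?_
    rw [h.eq_of_mem s hs b hb z hz, h.eq_of_mem t ht b' hb' z hz']
  have common : ∀ s ≤ N, ∀ t ≤ N, ∀ b < j, ∀ z ∈ g s b,
      (∀ s ≤ N, ∀ t ≤ N, φ (χ z) s = φ (χ z) t) → z ∈ g t b := by
    intro s hs t ht b hb z hz hc
    have : χ z ∈ (g t b).image χ := h.image s hs t ht b hb ▸ mem_image_of_mem χ hz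
    obtain ⟨w, hw, hwz⟩ := mem_image.1 this
    have h1 := h.eq_of_mem t ht b hb w hw
    rw [hwz, hc t ht s hs, h.eq_of_mem s hs b hb z hz] at h1
    exact h1 ▸ hw
  have hroot : Sh (j - 1) := by
    refine ⟨by omega, χ v, mem_image_of_mem χ ((h.path 0 (by omega)).root_mem hj), ?_⟩
    intro s hs t ht
    rw [h.eq_of_mem s hs (j - 1) (by omega) v ((h.path s hs).root_mem hj),
      h.eq_of_mem t ht (j - 1) (by omega) v ((h.path t ht).root_mem hj)]
  have hex : ∃ b, Sh b := ⟨_, hroot⟩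
  obtain ⟨haj, c, hc, hcc⟩ := Nat.find_spec hex
  have hmin : ∀ b < Nat.find hex, ¬ Sh b := fun b hb => Nat.find_min hex hb
  set a := Nat.find hex
  have hdisj : ∀ s ≤ N, ∀ t ≤ N, s ≠ t → ∀ b < a, ∀ b' < j, g s b ∩ g t b' = ∅ := by
    intro s hs t ht hst b hb b' hb'
    rw [← not_nonempty_iff_eq_empty]
    rintro ⟨z, hz⟩
    rw [mem_inter] at hz
    refine hmin b hb ⟨by omega, χ z, ?_,
      shared s hs t ht hst b (by omega) b' hb' z hz.1 hz.2⟩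
    rw [h.image 0 (by omega) s hs b (by omega)]
    exact mem_image_of_mem χ hz.1
  refine ⟨a, haj, ?_, hdisj⟩
  intro s hs t ht hst
  apply le_antisymm
  · rw [card_le_one]
    by_contra! hcon
    obtain ⟨z, hz, w, hw, hzw⟩ := hcon
    rw [mem_inter] at hz hw
    have hzc := shared s hs t ht hst a haj a haj z hz.1 hz.2
    have hwc := shared s hs t ht hst a haj a haj w hw.1 hw.2
    -- Two common vertices would lie in all the edges `g u a`, so the codegree bound makes two of
    -- these equal. For `a = 0` this contradicts the distinctness of the ends; for `a > 0` the
    -- preceding edge of one path would meet the other path.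
    have hmaps : ∀ u ∈ range (N + 1), g u a ∈ F.filter fun e => z ∈ e ∧ w ∈ e := by
      intro u hu
      have hu : u ≤ N := by rw [mem_range] at hu; omega
      exact mem_filter.2 ⟨(h.path u hu).mem a haj, common s hs u hu a haj z hz.1 hzc,
        common s hs u hu a haj w hw.1 hwc⟩
    obtain ⟨u, hu, u', hu', huu, heq⟩ := exists_ne_map_eq_of_card_lt_of_maps_to
      (by rw [card_range]; have := hD z w hzw; omega) hmaps
    have hu : u ≤ N := by rw [mem_range] at hu; omega
    have hu' : u' ≤ N := by rw [mem_range] at hu'; omega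
    rcases Nat.eq_zero_or_pos a with ha0 | hapos
    · have h1 : x u ∈ g u' a := by
        rw [← heq]; exact ((h.path u hu).mem_iff a haj).2 ha0
      have h2 : x u' ∈ g u' a := ((h.path u' hu').mem_iff a haj).2 ha0
      have e1 := h.eq_of_mem u' hu' a haj _ h1
      have e2 := h.eq_of_mem u' hu' a haj _ h2
      rw [h.colour u hu u' hu', e2] at e1
      exact h.injective u hu u' hu' huu e1.symm
    · have h1 := (h.path u hu).card_inter (a - 1) (by omega)
      rw [show a - 1 + 1 = a by omega] at h1
      obtain ⟨y, hy⟩ := card_pos.1 (by omega : 0 < (g u (a - 1) ∩ g u a).card)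
      rw [mem_inter] at hy
      have : y ∈ g u (a - 1) ∩ g u' a := mem_inter.2 ⟨hy.1, heq ▸ hy.2⟩
      rw [hdisj u hu u' hu' huu (a - 1) (by omega) a haj] at this
      exact notMem_empty _ this
  · rw [Nat.one_le_iff_ne_zero, ← Nat.pos_iff_ne_zero, card_pos]
    rw [h.image 0 (by omega) s hs a haj] at hc
    obtain ⟨z, hz, rfl⟩ := mem_image.1 hc
    exact ⟨z, mem_inter.2 ⟨hz, common s hs t ht a haj z hz hcc⟩⟩

/-- In a hypergraph of bounded codegree without loose cycles of length `2 * k + 1`, a positive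
proportion of the ends of loose paths with `j ≤ k` edges from a fixed vertex is independent. -/
theorem exists_indep_of_loosePaths [Fintype V] {F : Finset (Finset V)} {r D k j : ℕ} (hr : 0 < r)
    (hj : 0 < j) (hjk : j ≤ k) (hF2 : ∀ e ∈ F, 2 ≤ e.card) (hFr : ∀ e ∈ F, e.card ≤ r)
    (hD : ∀ x y : V, x ≠ y → (F.filter fun e => x ∈ e ∧ y ∈ e).card ≤ D)
    (hcyc : ¬ ∃ e : ZMod (2 * k + 1) → Finset V, IsLooseCycle e ∧ ∀ i, e i ∈ F)
    (W : Finset V) (v : V) (g : V → ℕ → Finset V) (hg : ∀ x ∈ W, IsLoosePath F j v x (g x)) :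
    ∃ I ⊆ W, Indep F I ∧ W.card ≤ indepConst r D k * I.card := by
  classical
  have hq : 0 < r * k := Nat.mul_pos hr (by omega)
  set q := r * k with hqdef
  let P : V → Finset V := fun x => (range j).biUnion (g x)
  have hPmem : ∀ x b z, b < j → z ∈ g x b → z ∈ P x := fun x b z hb hz =>
    mem_biUnion.2 ⟨b, mem_range.2 hb, hz⟩
  have hP : ∀ x ∈ W, (P x).card ≤ q := by
    intro x hx
    calc (P x).card ≤ (range j).card * r := card_biUnion_le_card_mul _ _ _ fun b hb =>
          hFr _ ((hg x hx).mem b (mem_range.1 hb))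
      _ ≤ q := by rw [card_range, hqdef, mul_comm]; exact Nat.mul_le_mul_left _ hjk
  obtain ⟨χ, hχ⟩ := exists_rainbow_colouring hq W P hP
  set W₁ := W.filter fun x => Set.InjOn χ (P x) with hW₁
  have : Nonempty (Fin q) := ⟨⟨0, hq⟩⟩
  let pat : V → (Fin k → Finset (Fin q)) × Fin q := fun x => (fun b => (g x b).image χ, χ x)
  obtain ⟨π, hπ⟩ := exists_large_fiber W₁ pat
  set W₂ := W₁.filter fun x => pat x = π with hW₂
  have hsub : W₂ ⊆ W := (filter_subset _ _).trans (filter_subset _ _)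
  have hinj : ∀ x ∈ W₂, Set.InjOn χ (P x) := fun x hx => (mem_filter.1 (mem_filter.1 hx).1).2
  have hpat : ∀ x ∈ W₂, pat x = π := fun x hx => (mem_filter.1 hx).2
  have hcol : ∀ x ∈ W₂, ∀ y ∈ W₂, χ x = χ y := fun x hx y hy =>
    congrArg Prod.snd ((hpat x hx).trans (hpat y hy).symm)
  -- All of `W₂` has one colour and the paths are rainbow. Hence edges inside `W₂` can meet the
  -- loose path from `x` only in `x`.
  have hPW : ∀ x ∈ W₂, ∀ z ∈ W₂, z ∈ P x → z = x := fun x hx z hz hzP =>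
    hinj x hx hzP (hPmem x 0 x hj (((hg x (hsub hx)).mem_iff 0 hj).2 rfl)) (hcol z hz x hx)
  let φ : Fin q → V → V := fun c x => if h : ∃ z ∈ P x, χ z = c then h.choose else x
  have hφ : ∀ x ∈ W₂, ∀ z ∈ P x, φ (χ z) x = z := by
    intro x hx z hz
    have h : ∃ w ∈ P x, χ w = χ z := ⟨z, hz, rfl⟩
    simp only [φ, dif_pos h]
    exact hinj x hx h.choose_spec.1 hz h.choose_spec.2
  -- The type of a pair compares, for each colour, its vertices on the two loose paths. In `N`, the
  -- term `2 * k + 1` leaves room for the cycle and `D` serves the pigeonhole in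
  -- `exists_meeting_index`.
  rcases exists_isMonotonePath_or_indep F hF2 W₂ (fun x y c => cmp (φ c x) (φ c y))
    (N := 2 * k + 1 + D) (by omega) with ⟨σ, x, e, hp⟩ | ⟨I, hIW, hI, hcard⟩
  swap
  · refine ⟨I, hIW.trans hsub, hI, ?_⟩
    calc W.card ≤ q ^ q * W₁.card := hχ
      _ ≤ q ^ q * (_ * (_ * I.card)) :=
        Nat.mul_le_mul_left _ (hπ.trans (Nat.mul_le_mul_left _ hcard))
      _ = indepConst r D k * I.card := by
        simp only [indepConst, ← hqdef]; ring
  exfalso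
  set N := 2 * k + 1 + D with hN
  have hxW : ∀ s ≤ N, x s ∈ W₂ := by
    intro s hs
    rcases Nat.eq_zero_or_pos s with rfl | h
    · exact (hp 0 (by omega)).2.1 (hp 0 (by omega)).2.2.1
    · have := hp (s - 1) (by omega)
      rw [show s - 1 + 1 = s by omega] at this
      exact this.2.1 this.2.2.2.1
  have hxne : ∀ s ≤ N, ∀ t ≤ N, s ≠ t → x s ≠ x t := by
    intro s hs t ht hst
    rcases Nat.lt_or_gt_of_ne hst with h | h
    · exact (hp.lt h ht).ne
    · exact (hp.lt h hs).ne'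
  have hsys : IsUniformPathSystem F j v χ N x (fun s => g (x s)) (fun c s => φ c (x s)) :=
    { path := fun s hs => hg _ (hsub (hxW s hs))
      colour := fun s hs t ht => hcol _ (hxW s hs) _ (hxW t ht)
      image := fun s hs t ht b hb => congrFun (congrArg Prod.fst
        ((hpat _ (hxW s hs)).trans (hpat _ (hxW t ht)).symm)) ⟨b, by omega⟩
      eq_of_mem := fun s hs b hb z hz => hφ _ (hxW s hs) z (hPmem _ b z hb hz)
      eq_or_ne := fun c => eq_or_ne_of_cmp_eq fun i hi => congrFun (hp i hi).2.2.2.2.2.2 c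
      injective := hxne }
  obtain ⟨a, haj, hone, hdis⟩ := hsys.exists_meeting_index hj (by omega) hD
  -- Since `a < j ≤ k`, at least one edge of the monotone path is left. The equal lengths of the two
  -- legs are what permits any odd total.
  obtain ⟨t, ht⟩ : ∃ t, 2 * k + 1 = t + 2 * (a + 1) := ⟨2 * k + 1 - 2 * (a + 1), by omega⟩
  have htN : t ≤ N := by omega
  have ht0 : 0 ≠ t := by omega
  have hpath := fun s hs => hg _ (hsub (hxW s hs))
  have hmeet : ∀ s ≤ N, ∀ i < t, ∀ b ≤ a, ∀ z ∈ e i ∩ g (x s) b, z = x s ∧ b = 0 := by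
    intro s hs i hi b hb z hz
    rw [mem_inter] at hz
    have hzx : z = x s := hPW _ (hxW s hs) z ((hp i (by omega)).2.1 hz.1)
      (hPmem _ b z (by omega) hz.2)
    exact ⟨hzx, ((hpath s hs).mem_iff b (by omega)).1 (hzx ▸ hz.2)⟩
  refine hcyc (exists_looseCycle_of_paths (t := t) (h := a + 1) (by omega) (by omega) ht
    (p := e) (g := g (x 0)) (g' := g (x t)) ?_ ?_ ?_ ?_ ?_ ?_ ?_ ?_ ?_ ?_ ?_ ?_ ?_ ?_ ?_)
  · exact fun i hi => (hp i (by omega)).1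
  · exact fun i hi => (hpath 0 (by omega)).mem i (by omega)
  · exact fun i hi => (hpath t htN).mem i (by omega)
  · intro i hi
    rw [card_eq_one]
    refine ⟨x (i + 1), eq_singleton_iff_unique_mem.2 ⟨mem_inter.2
      ⟨(hp i (by omega)).2.2.2.1, (hp (i + 1) (by omega)).2.2.1⟩, fun z hz => ?_⟩⟩
    rw [mem_inter] at hz
    exact le_antisymm ((hp i (by omega)).2.2.2.2.1 z hz.1).2
      ((hp (i + 1) (by omega)).2.2.2.2.1 z hz.2).1
  · intro i i' hii hi'
    rw [← not_nonempty_iff_eq_empty]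
    rintro ⟨z, hz⟩
    rw [mem_inter] at hz
    exact absurd ((((hp i' (by omega)).2.2.2.2.1 z hz.2).1).trans
      ((hp i (by omega)).2.2.2.2.1 z hz.1).2) (not_le.2 (hp.lt (by omega) (by omega)))
  · exact fun i hi => (hpath 0 (by omega)).card_inter i (by omega)
  · exact fun i i' h h' => (hpath 0 (by omega)).inter_eq_empty i i' h (by omega)
  · exact fun i hi => (hpath t htN).card_inter i (by omega)
  · exact fun i i' h h' => (hpath t htN).inter_eq_empty i i' h (by omega)
  · rw [card_eq_one]
    refine ⟨x 0, eq_singleton_iff_unique_mem.2 ⟨mem_inter.2 ⟨(hp 0 (by omega)).2.2.1,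
      ((hpath 0 (by omega)).mem_iff 0 hj).2 rfl⟩, fun z hz => ?_⟩⟩
    exact (hmeet 0 (by omega) 0 (by omega) 0 (by omega) z hz).1
  · have h1 := (hp (t - 1) (by omega)).2.2.2.1
    rw [show t - 1 + 1 = t by omega] at h1
    rw [card_eq_one]
    refine ⟨x t, eq_singleton_iff_unique_mem.2 ⟨mem_inter.2 ⟨h1,
      ((hpath t htN).mem_iff 0 hj).2 rfl⟩, fun z hz => ?_⟩⟩
    exact (hmeet t htN (t - 1) (by omega) 0 (by omega) z hz).1
  · intro i hi b hb hib
    rw [← not_nonempty_iff_eq_empty]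
    rintro ⟨z, hz⟩
    obtain ⟨rfl, rfl⟩ := hmeet 0 (by omega) i hi b (by omega) z hz
    have hi0 : 0 < i := by omega
    exact absurd ((hp i (by omega)).2.2.2.2.1 _ (mem_inter.1 hz).1).1
      (not_le.2 (hp.lt hi0 (by omega)))
  · intro i hi b hb hib
    rw [← not_nonempty_iff_eq_empty]
    rintro ⟨z, hz⟩
    obtain ⟨rfl, rfl⟩ := hmeet t htN i hi b (by omega) z hz
    exact absurd ((hp i (by omega)).2.2.2.2.1 _ (mem_inter.1 hz).1).2
      (not_le.2 (hp.lt (by omega) htN))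
  · exact hone 0 (by omega) t htN ht0
  · intro b hb b' hb' hbb
    rcases Nat.lt_or_ge b a with h | h
    · exact hdis 0 (by omega) t htN ht0 b h b' (by omega)
    · rw [inter_comm]
      exact hdis t htN 0 (by omega) (Ne.symm ht0) b' (by omega) b (by omega)

end Paths

/-! ### Growth of layers and deletion of independent sets. -/

section Growth

variable {V : Type*} [LinearOrder V] [Fintype V]

/-- The vertices of the edges of `F` that meet `W`. -/
def nbhd (F : Finset (Finset V)) (W : Finset V) : Finset V :=
  (F.filter fun e => ¬ Disjoint e W).biUnion id

open Classical in
/-- The ends of the loose paths in `F` with `j` edges from `v`. -/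
noncomputable def pathEnds (F : Finset (Finset V)) (j : ℕ) (v : V) : Finset V :=
  univ.filter fun x => ∃ g, IsLoosePath F j v x g

theorem mem_pathEnds {F : Finset (Finset V)} {j : ℕ} {v x : V} :
    x ∈ pathEnds F j v ↔ ∃ g, IsLoosePath F j v x g := by
  simp [pathEnds]

theorem pathEnds_zero (F : Finset (Finset V)) (v : V) : pathEnds F 0 v = {v} := by
  ext x
  rw [mem_pathEnds, mem_singleton]
  constructor
  · rintro ⟨g, hg⟩
    exact hg.eq_root rfl
  · rintro rfl
    exact ⟨fun _ => ∅, by constructor <;> simp⟩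

/-- An edge from an end `y` to a new vertex prolongs the path at `y` unless it meets that path in
some further `z`. There are at most `k * r` such `z`, each in at most `D` edges with `y`; the `+ 1`
counts `y` itself. -/
theorem card_nbhd_pathEnds_le {F : Finset (Finset V)} {r D k j : ℕ} (hjk : j ≤ k)
    (hFr : ∀ e ∈ F, e.card ≤ r)
    (hD : ∀ x y : V, x ≠ y → (F.filter fun e => x ∈ e ∧ y ∈ e).card ≤ D) (v : V) :
    (nbhd F (pathEnds F j v)).card ≤
      (pathEnds F (j + 1) v).card + (pathEnds F j v).card * (k * r * (D * r) + 1) := by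
  classical
  have hex : ∀ y, ∃ g, y ∈ pathEnds F j v → IsLoosePath F j v y g := by
    intro y
    by_cases hy : y ∈ pathEnds F j v
    · obtain ⟨g, hg⟩ := mem_pathEnds.1 hy
      exact ⟨g, fun _ => hg⟩
    · exact ⟨fun _ => ∅, fun h => absurd h hy⟩
  choose g hg using hex
  let P : V → Finset V := fun y => (range j).biUnion (g y)
  let B : V → Finset V := fun y => insert y (((P y).erase y).biUnion fun z =>
    (F.filter fun e => y ∈ e ∧ z ∈ e).biUnion id)
  have hB : ∀ y ∈ pathEnds F j v, (B y).card ≤ k * r * (D * r) + 1 := by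
    intro y hy
    refine (card_insert_le _ _).trans (Nat.add_le_add_right ?_ 1)
    have hP : ((P y).erase y).card ≤ k * r :=
      calc _ ≤ (P y).card := card_le_card (erase_subset _ _)
        _ ≤ (range j).card * r := card_biUnion_le_card_mul _ _ _ fun b hb =>
          hFr _ ((hg y hy).mem b (mem_range.1 hb))
        _ ≤ k * r := by rw [card_range]; exact Nat.mul_le_mul_right _ hjk
    refine (card_biUnion_le_card_mul _ _ (D * r) fun z hz => ?_).trans (Nat.mul_le_mul_right _ hP)
    refine (card_biUnion_le_card_mul _ _ r fun e he => hFr e (mem_filter.1 he).1).trans ?_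
    exact Nat.mul_le_mul_right _ (hD y z (ne_of_mem_erase hz).symm)
  have hsub : nbhd F (pathEnds F j v) ⊆ pathEnds F (j + 1) v ∪ (pathEnds F j v).biUnion B := by
    intro x hx
    obtain ⟨e, he, hxe⟩ := mem_biUnion.1 hx
    obtain ⟨heF, hmeet⟩ := mem_filter.1 he
    obtain ⟨y, hye, hy⟩ := not_disjoint_iff.1 hmeet
    have hxe : x ∈ e := hxe
    rw [mem_union, or_iff_not_imp_right]
    intro hxB
    have hxB : x ∉ B y := fun h => hxB (mem_biUnion.2 ⟨y, hy, h⟩)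
    rw [mem_pathEnds]
    refine (hg y hy).cons heF hxe hye (fun h => hxB (h ▸ mem_insert_self _ _)) ?_
    intro b hb z hz hze
    by_contra hzy
    exact hxB (mem_insert_of_mem (mem_biUnion.2 ⟨z,
      mem_erase.2 ⟨hzy, mem_biUnion.2 ⟨b, mem_range.2 hb, hz⟩⟩,
      mem_biUnion.2 ⟨e, mem_filter.2 ⟨heF, hye, hze⟩, hxe⟩⟩))
  exact (card_le_card hsub).trans ((card_union_le _ _).trans
    (Nat.add_le_add_left (card_biUnion_le_card_mul _ _ _ hB) _))

theorem exists_le_mul_of_lt_pow {w : ℕ → ℝ} {c : ℝ} (hc : 0 ≤ c) {k : ℕ} (h0 : w 0 = 1)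
    (hk : 0 < k) (hw : w k ≤ c ^ k) : ∃ j < k, 0 < w j ∧ w (j + 1) ≤ c * w j := by
  by_contra! h
  have key : ∀ j, j < k → c ^ (j + 1) < w (j + 1) := by
    intro j
    induction j with
    | zero => intro h'; have := h 0 h' (by rw [h0]; exact one_pos); rw [h0] at this; simpa using this
    | succ j ih =>
      intro h'
      calc c ^ (j + 1 + 1) = c * c ^ (j + 1) := by ring
        _ ≤ c * w (j + 1) := mul_le_mul_of_nonneg_left (ih (by omega)).le hc
        _ < _ := h _ h' ((pow_nonneg hc _).trans_lt (ih (by omega)))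
  have := key (k - 1) (by omega)
  rw [show k - 1 + 1 = k by omega] at this
  linarith

/-- The constant in `exists_indep_of_no_looseCycle`. -/
noncomputable def expansionConst (r D k : ℕ) : ℝ :=
  (indepConst r D k + (k * r * (D * r) + 2)) * indepConst r D k

theorem exists_indep_small_nbhd {F : Finset (Finset V)} {r D k n : ℕ} (hr : 0 < r) (hk : 0 < k)
    (hn : 1 ≤ n) (hF2 : ∀ e ∈ F, 2 ≤ e.card) (hFr : ∀ e ∈ F, e.card ≤ r)
    (hD : ∀ x y : V, x ≠ y → (F.filter fun e => x ∈ e ∧ y ∈ e).card ≤ D)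
    (hcyc : ¬ ∃ e : ZMod (2 * k + 1) → Finset V, IsLooseCycle e ∧ ∀ i, e i ∈ F)
    (hα : ∀ I, Indep F I → I.card < n) (U : Finset V) (hU : U.Nonempty) :
    ∃ I ⊆ U, I.Nonempty ∧ Indep F I ∧
      ((I ∪ nbhd (F.filter fun e => e ⊆ U) I).card : ℝ) ≤
        expansionConst r D k * (n : ℝ) ^ (1 / (k : ℝ)) * I.card := by
  classical
  obtain ⟨v, hv⟩ := hU
  -- Exploring only edges inside `U` keeps the layers in `U`, while independence is still obtained
  -- with respect to all of `F`.
  set F' := F.filter fun e => e ⊆ U with hF'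
  have hF'F : F' ⊆ F := filter_subset _ _
  set C := indepConst r D k with hC
  have hC1 : 1 ≤ C := indepConst_pos hr hk D
  have hindep : ∀ j ≤ k, ∃ I ⊆ pathEnds F' j v, I ⊆ U ∧ Indep F I ∧
      (pathEnds F' j v).card ≤ C * I.card := by
    intro j hj
    rcases Nat.eq_zero_or_pos j with rfl | hj0
    · refine ⟨{v}, by rw [pathEnds_zero], by simpa using hv, ?_, by rw [pathEnds_zero]; simpa⟩
      intro e he hev
      have := card_le_card hev
      have := hF2 e he
      simp at *
      omega
    · have hex : ∀ y, ∃ g, y ∈ pathEnds F' j v → IsLoosePath F' j v y g := by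
        intro y
        by_cases hy : y ∈ pathEnds F' j v
        · obtain ⟨g, hg⟩ := mem_pathEnds.1 hy
          exact ⟨g, fun _ => hg⟩
        · exact ⟨fun _ => ∅, fun h => absurd h hy⟩
      choose g hg using hex
      obtain ⟨I, hIW, hI, hcard⟩ := exists_indep_of_loosePaths hr hj0 hj hF2 hFr hD hcyc
        (pathEnds F' j v) v g fun x hx => (hg x hx).mono hF'F
      refine ⟨I, hIW, fun x hx => ?_, hI, hcard⟩
      have hp := hg x (hIW hx)
      exact (mem_filter.1 (hp.mem 0 hj0)).2 ((hp.mem_iff 0 hj0).2 rfl)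
  set lam : ℝ := (n : ℝ) ^ (1 / (k : ℝ)) with hlam
  have hlam1 : 1 ≤ lam := Real.one_le_rpow (by exact_mod_cast hn) (by positivity)
  have hlamk : lam ^ k = n := by
    rw [hlam, ← Real.rpow_natCast, ← Real.rpow_mul (by positivity), one_div,
      inv_mul_cancel₀ (by positivity), Real.rpow_one]
  have hC1' : (1 : ℝ) ≤ C := by exact_mod_cast hC1
  have hgrow : ∃ j < k, (0 : ℝ) < (pathEnds F' j v).card ∧
      ((pathEnds F' (j + 1) v).card : ℝ) ≤ (C * lam) * (pathEnds F' j v).card := by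
    refine exists_le_mul_of_lt_pow (w := fun j => ((pathEnds F' j v).card : ℝ)) (by positivity)
      (by simp [pathEnds_zero]) hk ?_
    obtain ⟨I, -, -, hI, hcard⟩ := hindep k le_rfl
    have h1 : ((pathEnds F' k v).card : ℝ) ≤ C * I.card := by exact_mod_cast hcard
    have h2 : (I.card : ℝ) ≤ n := by exact_mod_cast (hα I hI).le
    calc ((pathEnds F' k v).card : ℝ) ≤ C * n := h1.trans (by gcongr)
      _ ≤ (C : ℝ) ^ k * n := by gcongr; exact le_self_pow₀ hC1' hk.ne'
      _ = (C * lam) ^ k := by rw [mul_pow, hlamk]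
  obtain ⟨j, hjk, hpos, hj⟩ := hgrow
  obtain ⟨I, hIW, hIU, hI, hcard⟩ := hindep j hjk.le
  have hIne : I.Nonempty := by
    rw [nonempty_iff_ne_empty]
    rintro rfl
    rw [card_empty, mul_zero, Nat.le_zero] at hcard
    rw [hcard] at hpos
    simp at hpos
  refine ⟨I, hIU, hIne, hI, ?_⟩
  have hsub : I ∪ nbhd F' I ⊆ pathEnds F' j v ∪ nbhd F' (pathEnds F' j v) := by
    refine union_subset_union hIW (biUnion_subset_biUnion_of_subset_left _ ?_)
    intro e he
    rw [mem_filter] at he ⊢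
    exact ⟨he.1, fun h => he.2 (h.mono_right hIW)⟩
  have hnb := card_nbhd_pathEnds_le (F := F') hjk.le (fun e he => hFr e (hF'F he))
    (fun x y hxy => (card_le_card (filter_subset_filter _ hF'F)).trans (hD x y hxy)) v
  have h1 := (card_le_card hsub).trans ((card_union_le _ _).trans (Nat.add_le_add_left hnb _))
  have h2 : ((I ∪ nbhd F' I).card : ℝ) ≤ (pathEnds F' j v).card +
      ((pathEnds F' (j + 1) v).card + (pathEnds F' j v).card * (k * r * (D * r) + 1)) := by
    exact_mod_cast h1
  have h3 : ((pathEnds F' j v).card : ℝ) ≤ C * I.card := by exact_mod_cast hcard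
  calc ((I ∪ nbhd F' I).card : ℝ)
      ≤ (C * lam + (k * r * (D * r) + 2)) * (pathEnds F' j v).card := by linarith
    _ ≤ (C * lam + (k * r * (D * r) + 2) * lam) * (C * I.card) := by
        gcongr
        exact le_mul_of_one_le_right (by positivity) hlam1
    _ = expansionConst r D k * lam * I.card := by rw [expansionConst, ← hC]; ring

/-- Greedy deletion: every edge inside `U` that meets the chosen `I` lies in the deleted
neighbourhood, so no edge uses vertices of both `I` and the set found later. -/
theorem exists_indep_of_no_looseCycle {F : Finset (Finset V)} {r D k n : ℕ} (hr : 0 < r)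
    (hk : 0 < k) (hn : 1 ≤ n) (hF2 : ∀ e ∈ F, 2 ≤ e.card) (hFr : ∀ e ∈ F, e.card ≤ r)
    (hD : ∀ x y : V, x ≠ y → (F.filter fun e => x ∈ e ∧ y ∈ e).card ≤ D)
    (hcyc : ¬ ∃ e : ZMod (2 * k + 1) → Finset V, IsLooseCycle e ∧ ∀ i, e i ∈ F)
    (hα : ∀ I, Indep F I → I.card < n) (U : Finset V) :
    ∃ I ⊆ U, Indep F I ∧
      (U.card : ℝ) ≤ expansionConst r D k * (n : ℝ) ^ (1 / (k : ℝ)) * I.card := by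
  classical
  induction U using Finset.strongInduction with
  | H U ih =>
    rcases U.eq_empty_or_nonempty with rfl | hU
    · refine ⟨∅, Subset.refl _, fun e he hsub => ?_, by simp⟩
      have := hF2 e he
      rw [subset_empty.1 hsub, card_empty] at this
      omega
    · obtain ⟨I, hIU, hIne, hI, hcard⟩ :=
        exists_indep_small_nbhd hr hk hn hF2 hFr hD hcyc hα U hU
      set X := I ∪ nbhd (F.filter fun e => e ⊆ U) I with hX
      obtain ⟨x, hx⟩ := hIne
      have hss : U \ X ⊂ U :=
        (ssubset_iff_of_subset sdiff_subset).2 ⟨x, hIU hx, fun h =>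
          (mem_sdiff.1 h).2 (mem_union_left _ hx)⟩
      obtain ⟨J, hJU, hJ, hJcard⟩ := ih _ hss
      have hdisj : Disjoint I J := disjoint_left.2 fun y hy hyJ =>
        (mem_sdiff.1 (hJU hyJ)).2 (mem_union_left _ hy)
      refine ⟨I ∪ J, union_subset hIU (hJU.trans sdiff_subset), ?_, ?_⟩
      · intro e he hsub
        have heU : e ⊆ U := hsub.trans (union_subset hIU (hJU.trans sdiff_subset))
        by_cases hmeet : Disjoint e I
        · refine hJ e he fun y hy => ?_
          exact (mem_union.1 (hsub hy)).resolve_left (disjoint_left.1 hmeet hy)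
        · refine hI e he fun y hy => ?_
          refine (mem_union.1 (hsub hy)).resolve_right fun hyJ => ?_
          refine (mem_sdiff.1 (hJU hyJ)).2 (mem_union_right _ ?_)
          exact mem_biUnion.2 ⟨e, mem_filter.2 ⟨mem_filter.2 ⟨he, heU⟩, hmeet⟩, hy⟩
      · rw [card_union_of_disjoint hdisj]
        have h1 : (U.card : ℝ) ≤ X.card + (U \ X).card := by
          have := card_le_card_sdiff_add_card (s := U) (t := X)
          rw [add_comm] at this
          exact_mod_cast this
        push_cast
        linarith

end Growth

/-! ### From colourings to hypergraphs, and the Ramsey bound. -/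

section Ramsey

theorem arrows_of_expansionConst_lt {r k n m : ℕ} (hr : 2 ≤ r) (hk : 0 < k) (hn : 1 ≤ n)
    (hm : expansionConst r (((2 * k + 1) * r) ^ r) k * (n : ℝ) ^ (1 + 1 / (k : ℝ)) < m) :
    Arrows r (2 * k + 1) n m := by
  classical
  intro χ
  by_contra! hcon
  obtain ⟨hred, hblue⟩ := hcon
  let H : Finset (Finset (Fin m)) :=
    univ.filter fun e => ∃ h : e.card = r, χ ⟨e, h⟩ = Color.red
  have hH : ∀ h ∈ H, h.card = r := fun h hh => (mem_filter.1 hh).2.1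
  have hM : 1 ≤ (2 * k + 1) * r := Nat.mul_pos (by omega) (by omega)
  set F := core H ((2 * k + 1) * r) with hF
  have hcyc : ¬ ∃ e : ZMod (2 * k + 1) → Finset (Fin m), IsLooseCycle e ∧ ∀ i, e i ∈ F := by
    rintro ⟨e, he, heF⟩
    obtain ⟨e', he', hmem⟩ := exists_looseCycle_of_robust hH e he
      fun i => (mem_core.1 (heF i)).2.1
    refine hred ⟨fun i => ⟨e' i, hH _ (hmem i)⟩, he', fun i => ?_⟩
    exact (mem_filter.1 (hmem i)).2.2
  have hα : ∀ I, Indep F I → I.card < n := by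
    intro I hI
    by_contra! hcard
    have hI' : Indep H I := hI.of_core fun h hh => by rw [hH h hh]; exact hr
    obtain ⟨S, hSI, hS⟩ := exists_subset_card_eq hcard
    refine hblue ⟨S, hS, fun e heS => ?_⟩
    cases hc : χ e with
    | blue => rfl
    | red => exact absurd (heS.trans hSI) (hI' e (mem_filter.2 ⟨mem_univ _, e.2, hc⟩))
  obtain ⟨I, -, hI, hcard⟩ := exists_indep_of_no_looseCycle (F := F) (r := r)
    (by omega) hk hn (fun e he => (mem_core.1 he).1)
    (fun e he => (mem_core.1 he).2.1.card_le hH) (fun x y hxy => codegree_core_le hM hH hxy)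
    hcyc hα univ
  rw [card_univ, Fintype.card_fin] at hcard
  have h1 : (I.card : ℝ) ≤ n := by exact_mod_cast (hα I hI).le
  have h2 : (n : ℝ) ^ (1 + 1 / (k : ℝ)) = (n : ℝ) ^ (1 / (k : ℝ)) * n := by
    rw [add_comm, Real.rpow_add_one (by positivity)]
  have h3 : 0 ≤ expansionConst r (((2 * k + 1) * r) ^ r) k := by
    unfold expansionConst; positivity
  rw [h2, ← mul_assoc] at hm
  exact absurd (hcard.trans (mul_le_mul_of_nonneg_left h1 (by positivity))) (not_le.2 hm)

end Ramsey


end LooseCycleRamsey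

theorem theorem1p5 (r l : ℕ) (hr : 3 ≤ r) (hl : 5 ≤ l) (hodd : Odd l) :
    ∃ c : ℝ, 0 < c ∧ ∀ n : ℕ, 1 ≤ n →
      ∃ R : ℕ, LooseCycleRamsey.IsRamseyNumber r l n R ∧
        (R : ℝ) ≤ c * (n : ℝ) ^ (1 + 1 / ((l / 2 : ℕ) : ℝ)) := by
  classical
  obtain ⟨k, rfl⟩ := hodd
  have hk : 0 < k := by omega
  rw [show (2 * k + 1) / 2 = k by omega]
  set K := LooseCycleRamsey.expansionConst r (((2 * k + 1) * r) ^ r) k with hK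
  have hK0 : 0 ≤ K := by rw [hK, LooseCycleRamsey.expansionConst]; positivity
  -- The extra 1 absorbs the rounding in `⌊K * y⌋₊ + 1`, because `y ≥ 1`.
  refine ⟨K + 1, by positivity, fun n hn => ?_⟩
  set y : ℝ := (n : ℝ) ^ (1 + 1 / (k : ℝ)) with hy
  have hy1 : 1 ≤ y := Real.one_le_rpow (by exact_mod_cast hn) (by positivity)
  have harr : LooseCycleRamsey.Arrows r (2 * k + 1) n (⌊K * y⌋₊ + 1) :=
    LooseCycleRamsey.arrows_of_expansionConst_lt (by omega) hk hn
      (by rw [← hK, ← hy]; exact_mod_cast Nat.lt_floor_add_one (K * y))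
  have hex : ∃ m, LooseCycleRamsey.Arrows r (2 * k + 1) n m := ⟨_, harr⟩
  refine ⟨Nat.find hex, ⟨Nat.find_spec hex, fun m hm => Nat.find_min' hex hm⟩, ?_⟩
  have h1 : (Nat.find hex : ℝ) ≤ ((⌊K * y⌋₊ + 1 : ℕ) : ℝ) := by
    exact_mod_cast Nat.find_min' hex harr
  have h2 : (⌊K * y⌋₊ : ℝ) ≤ K * y := Nat.floor_le (by positivity)
  push_cast at h1
  linarith
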